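/- Let $I$ be a set and let $(n(i))_{i\in I}$ be an unbounded family of positive integers. Let $M=\prod_{i\in I}\mathbb M_{n(i)}$ (bounded families of matrices) act block-diagonally on $H=\bigoplus_{i\in I}\mathbb C^{n(i)}$ (and not on $L^2(M)$), so that the commutant is $M'\cong\ell^\infty(I)$, with $c\in\ell^\infty(I)$ acting on the block $\mathbb C^{n(i)}$ as the scalar $c_i$. For a family $Q=(Q_i)$ of positive definite matrices $Q_i\in\mathbb M_{n(i)}$ let $\varphi(x)=\sum_i\operatorname{Tr}(Q_ix_i)$ be the associated weight on $M$, let $\varphi^{-1}(T)=(\operatorname{Tr}(Q_i^{-1}T_{i,i}))_{i\in I}$ be the associated operator-valued weight from $\mathcal B(H)$ to $M'$, and let $\mathfrak n_{\varphi^{-1}}=\{\alpha\in\mathcal B(H):\|\varphi^{-1}(\alpha^*\alpha)\|<\infty\}$ with the $M'$-valued inner product $(\alpha|\beta)=\varphi^{-1}(\alpha^*\beta)$. For $\alpha\in\mathfrak n_{\varphi^{-1}}$ let $\hat\alpha:\ell^2(I)\to HS(H)$ be the bounded right $M'$-module map whose value at $\xi$ is the Hilbert--Schmidt operator with blocks $\hat\alpha(\xi)_{i,j}=\xi_j\,\alpha_{i,j}Q_j^{-1/2}$.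 For an $M'$-bimodule $V\subseteq HS(H)$ (a closed subspace with $M'VM'\subseteq V$) put $S=\{\alpha\in\mathfrak n_{\varphi^{-1}}:\hat\alpha(\ell^2(I))\subseteq V\}$, and let $e\in M\bar\otimes M^{\mathrm{op}}\subseteq\mathcal B(HS(H))$ be the orthogonal projection onto $V$. Call $S$ self-dual if every bounded right $M'$-module map $S\to M'$ has the form $\alpha\mapsto(\alpha_0|\alpha)$ for some $\alpha_0\in S$, and call $e$ integrable if $(\mathrm{id}\otimes\varphi^{\mathrm{op}})(e)<\infty$, that is, if there is a constant $C$ with $\varphi^{\mathrm{op}}((\omega_\xi\otimes\mathrm{id})(e))\le C\|\xi\|^2$ for all $\xi\in H$, where $\omega_\xi(x)=(\xi|x\xi)$. Then there are a family $Q$ of positive definite matrices such that $\varphi^{-1}$ is bounded, and even $\operatorname{Tr}(Q_i^{-1})=1$ for every $i$, and an $M'$-bimodule $V\subseteq HS(H)$ such that $S$ is self-dual, and moreover every bounded right $M'$-module map $t:\ell^2(I)\to V$ is of the form $t=\hat\alpha$ with $\alpha\in S$, but the projection $e$ onto $V$ is not integrable. -/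

import Mathlib

open scoped ComplexOrder MatrixOrder Matrix.Norms.L2Operator ENNReal InnerProductSpace

noncomputable section

namespace MatrixQG

/-- The Hilbert space `H = ⨁ᵢ ℂ^{n(i)}` (an `ℓ²`-direct sum). -/
abbrev Hil {I : Type*} (n : I → ℕ) : Type _ := lp (fun i => EuclideanSpace ℂ (Fin (n i))) 2

/-- The bounded operators on `H`. -/
abbrev BH {I : Type*} (n : I → ℕ) : Type _ := Hil n →L[ℂ] Hil n

/-- The index set of the standard orthonormal basis of `H`. -/
abbrev Idx {I : Type*} (n : I → ℕ) : Type _ := Σ i, Fin (n i)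

/-- The Hilbert space `HS(H)`.  A Hilbert--Schmidt operator is stored as its square-summable family
of columns, that is, its values on the standard orthonormal basis of `H`, so that the norm and inner
product are the Hilbert--Schmidt ones.  The operator itself is recovered by `hsOp` below. -/
abbrev HS {I : Type*} (n : I → ℕ) : Type _ := lp (fun _ : Idx n => Hil n) 2

/-- The Hilbert space `ℓ²(I)`: the GNS space of `M' ≅ ℓ^∞(I)` for the counting weight. -/
abbrev Ell2 (I : Type*) : Type _ := lp (fun _ : I => ℂ) 2

lemma hasSum_norm_sq {J : Type*} {E : J → Type*} [∀ j, NormedAddCommGroup (E j)] (f : lp E 2) :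
    HasSum (fun j => ‖f j‖ ^ (2 : ℝ)) (‖f‖ ^ (2 : ℝ)) := by
  simpa using lp.hasSum_norm (p := 2) (by norm_num) f

lemma hasSum_coord {I : Type*} {n : I → ℕ} (ξ : Hil n) :
    HasSum (fun x : Idx n => ‖ξ x.1 x.2‖ ^ (2 : ℝ)) (‖ξ‖ ^ (2 : ℝ)) := by
  have h1 := hasSum_norm_sq ξ
  have h2 : ∀ i, HasSum (fun k => ‖ξ i k‖ ^ (2 : ℝ)) (‖ξ i‖ ^ (2 : ℝ)) := by
    intro i
    have : ‖ξ i‖ ^ (2 : ℝ) = ∑ k, ‖ξ i k‖ ^ (2 : ℝ) := by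
      simp [EuclideanSpace.norm_sq_eq]
    rw [this]
    exact hasSum_fintype _
  have hs : Summable (fun x : Idx n => ‖ξ x.1 x.2‖ ^ (2 : ℝ)) := by
    rw [summable_sigma_of_nonneg (fun x => by positivity)]
    refine ⟨fun i => (h2 i).summable, ?_⟩
    simpa only [(h2 _).tsum_eq] using h1.summable
  have := hs.hasSum.sigma h2
  rw [← this.unique h1]
  exact hs.hasSum

lemma summable_and_bound {I : Type*} {n : I → ℕ} (v : HS n) (ξ : Hil n) :
    Summable (fun x : Idx n => ‖(ξ x.1 x.2) • v x‖) ∧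
      ∑' x : Idx n, ‖(ξ x.1 x.2) • v x‖ ≤ ‖v‖ * ‖ξ‖ := by
  have h := Real.summable_and_inner_le_Lp_mul_Lq_tsum_of_nonneg Real.HolderConjugate.two_two
    (f := fun x : Idx n => ‖ξ x.1 x.2‖) (g := fun x => ‖v x‖)
    (fun _ => norm_nonneg _) (fun _ => norm_nonneg _)
    (hasSum_coord ξ).summable (hasSum_norm_sq v).summable
  rw [(hasSum_coord ξ).tsum_eq, (hasSum_norm_sq v).tsum_eq] at h
  have e : ∀ a : ℝ, 0 ≤ a → (a ^ (2 : ℝ)) ^ (1 / (2 : ℝ)) = a := by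
    intro a ha
    rw [← Real.rpow_mul ha]; norm_num
  rw [e _ (norm_nonneg _), e _ (norm_nonneg _)] at h
  simp only [norm_smul]
  exact ⟨h.1, by linarith [h.2, mul_comm ‖ξ‖ ‖v‖]⟩

/-- The bounded operator on `H` with the given square-summable family of columns:
`ξ ↦ ∑ₓ ξₓ v(x)`. -/
def hsOp {I : Type*} {n : I → ℕ} (v : HS n) : BH n :=
  LinearMap.mkContinuous
    { toFun := fun ξ => ∑' x : Idx n, (ξ x.1 x.2) • v x
      map_add' := by
        intro ξ η
        rw [← (summable_and_bound v ξ).1.of_norm.tsum_add (summable_and_bound v η).1.of_norm]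
        simp [add_smul]
      map_smul' := by
        intro c ξ
        rw [RingHom.id_apply, ← (summable_and_bound v ξ).1.of_norm.tsum_const_smul c]
        simp [mul_smul] }
    ‖v‖ (fun ξ => (norm_tsum_le_tsum_norm (summable_and_bound v ξ).1).trans
      (summable_and_bound v ξ).2)

/-- The standard orthonormal basis of `H`: the `k`-th unit vector of the `i`-th block. -/
def basisVec {I : Type*} [DecidableEq I] (n : I → ℕ) (x : Idx n) : Hil n :=
  lp.single 2 x.1 (EuclideanSpace.single x.2 1)

/-- The `(i, j)` block of `T`, the matrix of a map `ℂ^{n(j)} → ℂ^{n(i)}`. -/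
def block {I : Type*} [DecidableEq I] {n : I → ℕ} (T : BH n) (i j : I) :
    Matrix (Fin (n i)) (Fin (n j)) ℂ :=
  Matrix.of fun k l => (T (basisVec n ⟨j, l⟩)) i k

/-- `M = ∏ᵢ 𝕄_{n(i)}` acting block-diagonally on `H`.  As `x` is a bounded operator, exactly the
families of matrices with uniformly bounded operator norm occur. -/
def alg {I : Type*} (n : I → ℕ) : Set (BH n) :=
  {x | ∃ a : ∀ i, Matrix (Fin (n i)) (Fin (n i)) ℂ,
    ∀ (ξ : Hil n) (i : I), (x ξ) i = Matrix.toEuclideanLin (a i) (ξ i)}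

/-- The commutant `M'` of `M` in `𝓑(H)`. -/
def comm {I : Type*} (n : I → ℕ) : Set (BH n) := Set.centralizer (alg n)

/-- `a` acts on each block `i` as multiplication by the scalar `c i`.  This is the identification of
an element `a` of `M'` with an element `c` of `ℓ^∞(I)`. -/
def ActsBy {I : Type*} {n : I → ℕ} (a : BH n) (c : I → ℂ) : Prop :=
  ∀ (ξ : Hil n) (i : I), (a ξ) i = c i • ξ i

/-- `V` is an `M'`-bimodule in `HS(H)`: a closed subspace with `a v b ∈ V` for `v ∈ V` and
`a, b ∈ M'`. -/
def IsHSBimodule {I : Type*} {n : I → ℕ} (V : Submodule ℂ (HS n)) : Prop :=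
  IsClosed (V : Set (HS n)) ∧
    ∀ v ∈ V, ∀ a ∈ comm n, ∀ b ∈ comm n, ∃ w ∈ V, hsOp w = a * hsOp v * b

/-! In what follows `Q = (Q_i)` is a family of positive definite matrices. -/

/-- The weight `φ(y) = Tr(Q y) = ∑ᵢ Tr(Q_i y_i)`, for `y = (y_i)` positive in `M`. -/
def weight {I : Type*} {n : I → ℕ} (Q : ∀ i, Matrix (Fin (n i)) (Fin (n i)) ℂ)
    (y : ∀ i, Matrix (Fin (n i)) (Fin (n i)) ℂ) : ℝ≥0∞ :=
  ∑' i, ENNReal.ofReal (Q i * y i).trace.re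

/-- The operator-valued weight `φ⁻¹` from `𝓑(H)` to `M' ≅ ℓ^∞(I)`, namely
`φ⁻¹(T) = (Tr(Q_i⁻¹ T_{i,i}))_i`.  For `T ≥ 0` the value is a non-negative function on `I`, hence an
element of the extended positive part of `ℓ^∞(I)`; it is finite when this function is bounded. -/
def invWeight {I : Type*} [DecidableEq I] {n : I → ℕ}
    (Q : ∀ i, Matrix (Fin (n i)) (Fin (n i)) ℂ) (T : BH n) (i : I) : ℂ :=
  ((Q i)⁻¹ * block T i i).trace

/-- `φ⁻¹` is bounded. -/
def InvWeightBounded {I : Type*} [DecidableEq I] {n : I → ℕ}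
    (Q : ∀ i, Matrix (Fin (n i)) (Fin (n i)) ℂ) : Prop :=
  ∃ C : ℝ, ∀ T : BH n, T.IsPositive → ∀ i, ‖invWeight Q T i‖ ≤ C * ‖T‖

/-- The `M'`-valued inner product `(α|β) = φ⁻¹(α* β)`, as a function on `I`. -/
def modInner {I : Type*} [DecidableEq I] {n : I → ℕ}
    (Q : ∀ i, Matrix (Fin (n i)) (Fin (n i)) ℂ) (α β : BH n) : I → ℂ :=
  invWeight Q (ContinuousLinearMap.adjoint α * β)

/-- `𝔫_{φ⁻¹} = {α : ‖φ⁻¹(α* α)‖ < ∞}`. -/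
def nInv {I : Type*} [DecidableEq I] {n : I → ℕ}
    (Q : ∀ i, Matrix (Fin (n i)) (Fin (n i)) ℂ) : Set (BH n) :=
  {α | BddAbove (Set.range fun i => ‖modInner Q α α i‖)}

/-- The square `‖(α|α)‖ = ‖φ⁻¹(α* α)‖` of the module norm of `α ∈ 𝔫_{φ⁻¹}`. -/
def modNormSq {I : Type*} [DecidableEq I] {n : I → ℕ}
    (Q : ∀ i, Matrix (Fin (n i)) (Fin (n i)) ℂ) (α : BH n) : ℝ :=
  ⨆ i, ‖modInner Q α α i‖

/-- The columns of the Hilbert--Schmidt operator `α̂(ξ) = α ξ Q^{-1/2}` for `ξ ∈ ℓ²(I)`, where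
`ξ` acts on `H` as multiplication by `ξ_j` on the block `j`. -/
def hatCol {I : Type*} [DecidableEq I] {n : I → ℕ}
    (Q : ∀ i, Matrix (Fin (n i)) (Fin (n i)) ℂ) (α : BH n) (ξ : Ell2 I) (x : Idx n) : Hil n :=
  ξ x.1 • α (lp.single 2 x.1
    (Matrix.toEuclideanLin (CFC.sqrt (Q x.1)⁻¹) (EuclideanSpace.single x.2 1)))

/-- `S = {α ∈ 𝔫_{φ⁻¹} : Im(α̂) ⊆ V}`. -/
def modS {I : Type*} [DecidableEq I] {n : I → ℕ}
    (Q : ∀ i, Matrix (Fin (n i)) (Fin (n i)) ℂ) (V : Submodule ℂ (HS n)) : Set (BH n) :=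
  {α | α ∈ nInv Q ∧ ∀ ξ : Ell2 I, ∃ v ∈ V, ∀ x, v x = hatCol Q α ξ x}

/-- `S` is self-dual as an inner product module over `M'`: each bounded right `M'`-module map
`F : S → M'` is of the form `α ↦ (α₀|α)` for some `α₀ ∈ S`.  (Only the values of `F` on the right
`M'`-module `S` are constrained.  Complex homogeneity is the case of scalar `a`.) -/
def IsSelfDual {I : Type*} [DecidableEq I] {n : I → ℕ}
    (Q : ∀ i, Matrix (Fin (n i)) (Fin (n i)) ℂ) (S : Set (BH n)) : Prop :=
  ∀ F : BH n → BH n,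
    (∀ α ∈ S, F α ∈ comm n) →
    (∀ α ∈ S, ∀ β ∈ S, F (α + β) = F α + F β) →
    (∀ α ∈ S, ∀ a ∈ comm n, F (α * a) = F α * a) →
    (∃ C : ℝ, ∀ α ∈ S, ‖F α‖ ^ 2 ≤ C * modNormSq Q α) →
    ∃ α₀ ∈ S, ∀ α ∈ S, ActsBy (F α) (modInner Q α₀ α)

/-- `t ∈ 𝓑_{M'}(ℓ²(I), HS(H))`: the bounded operator `t` satisfies `t(ξ·a) = t(ξ) a` for `a ∈ M'`,
where `a` acts on `ℓ²(I)` by pointwise multiplication and on `HS(H)` by right composition. -/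
def IsModuleMap {I : Type*} {n : I → ℕ} (t : Ell2 I →L[ℂ] HS n) : Prop :=
  ∀ a ∈ comm n, ∀ c : I → ℂ, ActsBy a c →
    ∀ ξ η : Ell2 I, (∀ i, η i = ξ i * c i) → hsOp (t η) = hsOp (t ξ) * a

/-- The slice `y = (ω_ξ ⊗ id)(e)` in `M^op`, regarded as a family of matrices, for `e` in
`M ⊗̄ M^op ⊆ 𝓑(H ⊗ H̄) = 𝓑(HS(H))` and the vector functional `ω_ξ`.  The element `x^op` acts on `H̄`
as the transpose of `x`, so `⟨f', y f⟩ = ⟨ξ ⊗ f̄, e (ξ ⊗ f̄')⟩` for vectors `f, f'` of `H`; here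
`ξ ⊗ f̄`, for a basis vector `f`, is the rank one operator whose only non-zero column is `ξ`. -/
def slice {I : Type*} [DecidableEq I] {n : I → ℕ} (e : HS n →L[ℂ] HS n) (ξ : Hil n) (i : I) :
    Matrix (Fin (n i)) (Fin (n i)) ℂ :=
  Matrix.of fun k' k =>
    ⟪(lp.single 2 (⟨i, k⟩ : Idx n) ξ : HS n), e (lp.single 2 (⟨i, k'⟩ : Idx n) ξ)⟫_ℂ

/-- The projection `e` is integrable: `(id ⊗ φ^op)(e) < ∞`, that is, the element
`ω ↦ φ^op((ω ⊗ id)(e))` of the extended positive part of `M` is bounded.  Since it is countably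
additive in `ω`, it suffices to bound it on vector functionals. -/
def IsIntegrable {I : Type*} [DecidableEq I] {n : I → ℕ}
    (Q : ∀ i, Matrix (Fin (n i)) (Fin (n i)) ℂ) (e : HS n →L[ℂ] HS n) : Prop :=
  ∃ C : ℝ, ∀ ξ : Hil n, weight Q (slice e ξ) ≤ ENNReal.ofReal (C * ‖ξ‖ ^ 2)

end MatrixQG

end

/-!
Let the block `i` of `V` consist of the matrices `w` with arbitrary `0`-th column `c` and with
`l`-th column `√pₗ cₗ e₀` for `l ≠ 0`, where `p` is a probability vector on the block and `Q⁻¹` is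
the diagonal matrix of `p`.  Dividing the `l`-th column by `√pₗ` gives
`w Q^{1/2} η = p₀^{-1/2} η₀ c + (∑_{l ≠ 0} cₗ ηₗ) e₀`, so the operator norm of `w Q^{1/2}` is at
most `(p₀^{-1/2} + 1) ‖c‖`.  As `p₀` stays away from `0`, the operators `w Q^{1/2}` coming from the
blocks of a bounded module map `ℓ²(I) → V` form a bounded operator `α`, and the map is `α̂`.

For any closed `V` with this property, a bounded module map `S → M'` restricts to bounded
functionals on the pairwise orthogonal spaces `V p_j`, with `p_j` the projection onto the block `j`.
The representing vectors are uniformly bounded and define a module map `ℓ²(I) → V`, hence an element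
of `S`, which gives self-duality.

The operator whose only non-zero column is `e₀` in position `k ≠ 0` has inner product `√pₖ` with an
element of `V` of norm at most `2`, so its component in `V` has squared norm at least `pₖ / 4`.  The
weight multiplies this by `pₖ⁻¹`, and summing over `k` gives at least `(n(j) - 1) / 4` at the unit
vector `e₀` of the block `j`, which is unbounded in `j`.
-/

noncomputable section

namespace MatrixQG

variable {I : Type*} {n : I → ℕ}

lemma ActsBy.mem_comm {a : BH n} {c : I → ℂ} (h : ActsBy a c) : a ∈ comm n := by
  rintro x ⟨A, hA⟩
  ext ξ i : 3
  simp only [mul_apply_eq_comp, hA, h _ i, map_smul]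

lemma sum_norm_col_sq_le (v : HS n) (i : I) : ∑ l, ‖v ⟨i, l⟩‖ ^ 2 ≤ ‖v‖ ^ 2 := by
  have h := lp.sum_rpow_le_norm_rpow (by norm_num) v
    (Finset.univ.map (Function.Embedding.sigmaMk i))
  simpa using h

/-- The elements of `V` whose only non-zero columns belong to the block `j`; for a bimodule `V` this
is `V p`, with `p` the minimal projection of `M'` onto the block `j`. -/
def columnPart (V : Submodule ℂ (HS n)) (j : I) : Submodule ℂ (HS n) where
  carrier := {v | v ∈ V ∧ ∀ x : Idx n, x.1 ≠ j → v x = 0}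
  zero_mem' := ⟨V.zero_mem, fun _ _ => rfl⟩
  add_mem' hv hw := ⟨V.add_mem hv.1 hw.1, fun x hx => by simp [hv.2 x hx, hw.2 x hx]⟩
  smul_mem' z _ hv := ⟨V.smul_mem z hv.1, fun x hx => by simp [hv.2 x hx]⟩

lemma isClosed_columnPart {V : Submodule ℂ (HS n)} (hV : IsClosed (V : Set (HS n))) (j : I) :
    IsClosed (columnPart V j : Set (HS n)) := by
  have hcols : (columnPart V j : Set (HS n)) =
      (V : Set (HS n)) ∩ ⋂ x : Idx n, ⋂ _ : x.1 ≠ j, {v : HS n | v x = 0} := by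
    ext v
    simp [columnPart]
  rw [hcols]
  exact hV.inter (isClosed_iInter fun x => isClosed_iInter fun _ =>
    isClosed_eq (lp.lipschitzWith_one_eval 2 x).continuous continuous_const)

lemma inner_eq_sum_of_mem_columnPart {V : Submodule ℂ (HS n)} {j : I} {v : HS n}
    (hv : v ∈ columnPart V j) (w : HS n) : ⟪v, w⟫_ℂ = ∑ l, ⟪v ⟨j, l⟩, w ⟨j, l⟩⟫_ℂ := by
  rw [lp.inner_eq_tsum, tsum_eq_sum (s := Finset.univ.map (Function.Embedding.sigmaMk j))]
  · simp
  · rintro ⟨i, l⟩ hx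
    have hij : i ≠ j := by
      rintro rfl
      simp at hx
    rw [hv.2 _ hij, inner_zero_left]

section Basis

variable [DecidableEq I]

lemma inner_basisVec (x : Idx n) (ξ : Hil n) : ⟪basisVec n x, ξ⟫_ℂ = ξ x.1 x.2 := by
  rw [basisVec, lp.inner_single_left, EuclideanSpace.inner_single_left]
  simp

@[simp]
lemma norm_basisVec (x : Idx n) : ‖basisVec n x‖ = 1 := by
  rw [basisVec, lp.norm_single (by norm_num), PiLp.norm_single, norm_one]

lemma basisVec_apply_same (i : I) (k l : Fin (n i)) :
    basisVec n ⟨i, k⟩ i l = if l = k then 1 else 0 := by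
  simp [basisVec]

lemma basisVec_apply_of_ne {i j : I} (h : j ≠ i) (k : Fin (n i)) : basisVec n ⟨i, k⟩ j = 0 := by
  simp [basisVec, Pi.single_eq_of_ne h]

lemma basisVec_apply (x y : Idx n) : basisVec n x y.1 y.2 = if y = x then 1 else 0 := by
  obtain ⟨i, k⟩ := x
  obtain ⟨j, l⟩ := y
  by_cases h : j = i
  · subst h
    simp [basisVec_apply_same]
  · simp [basisVec_apply_of_ne h, h]

lemma ext_basisVec {S T : BH n} (h : ∀ x, S (basisVec n x) = T (basisVec n x)) : S = T := by
  refine lp.ext_continuousLinearMap (by norm_num) fun i => ?_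
  refine ContinuousLinearMap.coe_injective ?_
  refine (EuclideanSpace.basisFun (Fin (n i)) ℂ).toBasis.ext fun k => ?_
  simpa [basisVec] using h ⟨i, k⟩

lemma hsOp_basisVec (v : HS n) (x : Idx n) : hsOp v (basisVec n x) = v x := by
  change ∑' y : Idx n, basisVec n x y.1 y.2 • v y = v x
  rw [tsum_eq_single x fun y hy => by simp [basisVec_apply, hy]]
  simp [basisVec_apply]

end Basis

section Commutant

variable [DecidableEq I]

lemma ActsBy.apply_single {a : BH n} {c : I → ℂ} (h : ActsBy a c) (j : I)
    (η : EuclideanSpace ℂ (Fin (n j))) : a (lp.single 2 j η) = c j • lp.single 2 j η := by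
  ext i : 2
  rw [h]
  by_cases hi : i = j
  · subst hi; simp
  · simp [Pi.single_eq_of_ne hi]

lemma ActsBy.apply_basisVec {a : BH n} {c : I → ℂ} (h : ActsBy a c) (x : Idx n) :
    a (basisVec n x) = c x.1 • basisVec n x :=
  h.apply_single x.1 _

/-- The projection of `H` onto its block `j`, a minimal projection of `M'`. -/
def blockProj (n : I → ℕ) (j : I) : BH n :=
  (lp.singleContinuousLinearMap ℂ (fun i => EuclideanSpace ℂ (Fin (n i))) 2 j).comp
    (lp.evalCLM ℂ (fun i => EuclideanSpace ℂ (Fin (n i))) 2 j)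

lemma actsBy_blockProj (j : I) : ActsBy (blockProj n j) (Pi.single j 1) := by
  intro ξ i
  change (lp.single 2 j (ξ j) : Hil n) i = _
  by_cases h : i = j
  · subst h; simp
  · simp [Pi.single_eq_of_ne h]

/-- The matrix unit of the block `i` of `M` with entry `1` at `(k, l)`. -/
def matrixUnit (i : I) (k l : Fin (n i)) : BH n :=
  (innerSL ℂ (basisVec n ⟨i, l⟩)).smulRight (basisVec n ⟨i, k⟩)

lemma matrixUnit_apply (i : I) (k l : Fin (n i)) (ξ : Hil n) :
    matrixUnit i k l ξ = ξ i l • basisVec n ⟨i, k⟩ := by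
  simp only [matrixUnit, ContinuousLinearMap.smulRight_apply, innerSL_apply_apply, inner_basisVec]

lemma matrixUnit_mem_alg (i : I) (k l : Fin (n i)) : matrixUnit i k l ∈ alg n := by
  refine ⟨Pi.single i (Matrix.single k l 1), fun ξ j => ?_⟩
  rw [matrixUnit_apply]
  by_cases h : j = i
  · subst h
    ext r
    simp [basisVec_apply_same, Matrix.single_mulVec, Function.update_apply]
  · simp [basisVec_apply_of_ne h, Pi.single_eq_of_ne h]

variable [∀ i, NeZero (n i)]

/-- The `i`-th coordinate in `ℓ^∞(I)` of an element of `M'`, read off from the first diagonal entry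
of the block `i`; it is defined for every operator on `H`, so as to be linear in it. -/
def blockScalar (a : BH n) (i : I) : ℂ := a (basisVec n ⟨i, 0⟩) i 0

lemma actsBy_blockScalar {a : BH n} (ha : a ∈ comm n) : ActsBy a (blockScalar a) := by
  intro ξ i
  ext k
  have h := congrArg (fun T : BH n => T ξ i 0) (ha _ (matrixUnit_mem_alg i 0 k))
  simpa [matrixUnit_apply, basisVec_apply_same, blockScalar, mul_comm] using h

lemma blockScalar_mul (a : BH n) {b : BH n} {c : I → ℂ} (hb : ActsBy b c) (i : I) :
    blockScalar (a * b) i = c i * blockScalar a i := by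
  simp [blockScalar, hb.apply_basisVec]

lemma norm_blockScalar_le (a : BH n) (i : I) : ‖blockScalar a i‖ ≤ ‖a‖ := by
  calc ‖blockScalar a i‖ ≤ ‖a (basisVec n ⟨i, 0⟩) i‖ := PiLp.norm_apply_le _ _
    _ ≤ ‖a (basisVec n ⟨i, 0⟩)‖ := lp.norm_apply_le_norm (by norm_num) _ _
    _ ≤ ‖a‖ := by simpa using a.le_opNorm (basisVec n ⟨i, 0⟩)

lemma exists_hsOp_eq_mul_mul (v : HS n) (a : BH n) {b : BH n} (hb : b ∈ comm n) :
    ∃ w : HS n, hsOp w = a * hsOp v * b ∧ ∀ x, w x = blockScalar b x.1 • a (v x) := by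
  have hmem : Memℓp (fun x : Idx n => blockScalar b x.1 • a (v x)) 2 := by
    refine ((lp.memℓp v).norm.const_mul (‖b‖ * ‖a‖)).mono fun x => ?_
    rw [norm_smul, mul_assoc]
    gcongr
    exacts [norm_blockScalar_le b _, a.le_opNorm _]
  refine ⟨⟨_, hmem⟩, ext_basisVec fun x => ?_, fun _ => rfl⟩
  simp [hsOp_basisVec, (actsBy_blockScalar hb).apply_basisVec]

end Commutant

section ModuleMap

variable [DecidableEq I]

lemma isModuleMap_iff {t : Ell2 I →L[ℂ] HS n} :
    IsModuleMap t ↔ ∀ ξ x, t ξ x = ξ x.1 • t (lp.single 2 x.1 1) x := by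
  constructor
  · intro ht ξ x
    have h := ht _ (actsBy_blockProj x.1).mem_comm _ (actsBy_blockProj x.1) ξ
      (ξ x.1 • lp.single 2 x.1 1) (fun i => by
        by_cases h : i = x.1
        · subst h; simp
        · simp [Pi.single_eq_of_ne h])
    have h2 := congrArg (fun T : BH n => T (basisVec n x)) h
    simpa [hsOp_basisVec, (actsBy_blockProj x.1).apply_basisVec] using h2.symm
  · intro h a _ c hac ξ η hη
    refine ext_basisVec fun x => ?_
    rw [mul_apply_eq_comp, hac.apply_basisVec, map_smul, hsOp_basisVec, hsOp_basisVec, h η, h ξ,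
      hη, mul_comm, mul_smul]

end ModuleMap

section WeightedBasis

variable [DecidableEq I] {Q : ∀ i, Matrix (Fin (n i)) (Fin (n i)) ℂ}

/-- The vectors `Q^{-1/2} eₓ` for the standard basis `(eₓ)` of `H`.  They relate all the structure
to evaluations of operators: `α̂(ξ)` has the columns `ξ_j α(Q^{-1/2} eₓ)`, and `φ⁻¹` is given by the
corresponding sums of vector functionals. -/
def weightedBasisVec (Q : ∀ i, Matrix (Fin (n i)) (Fin (n i)) ℂ) (x : Idx n) : Hil n :=
  lp.single 2 x.1 (Matrix.toEuclideanLin (CFC.sqrt (Q x.1)⁻¹) (EuclideanSpace.single x.2 1))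

lemma hatCol_eq_smul (α : BH n) (ξ : Ell2 I) (x : Idx n) :
    hatCol Q α ξ x = ξ x.1 • α (weightedBasisVec Q x) :=
  rfl

lemma ActsBy.apply_weightedBasisVec {a : BH n} {c : I → ℂ} (h : ActsBy a c) (x : Idx n) :
    a (weightedBasisVec Q x) = c x.1 • weightedBasisVec Q x :=
  h.apply_single x.1 _

lemma single_eq_sum_basisVec (i : I) (η : EuclideanSpace ℂ (Fin (n i))) :
    (lp.single 2 i η : Hil n) = ∑ k, η k • basisVec n ⟨i, k⟩ := by
  conv_lhs => rw [← (EuclideanSpace.basisFun _ ℂ).sum_repr η]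
  exact (map_sum (lp.singleContinuousLinearMap ℂ
    (fun i => EuclideanSpace ℂ (Fin (n i))) 2 i) _ _).trans (by simp [basisVec])

lemma weightedBasisVec_eq_sum (i : I) (l : Fin (n i)) :
    weightedBasisVec Q ⟨i, l⟩ = ∑ k, CFC.sqrt (Q i)⁻¹ k l • basisVec n ⟨i, k⟩ := by
  rw [weightedBasisVec, single_eq_sum_basisVec]
  simp

lemma basisVec_eq_sum_weightedBasisVec (hQ : ∀ i, (Q i).PosDef) (i : I) (l : Fin (n i)) :
    basisVec n ⟨i, l⟩ = ∑ k, (CFC.sqrt (Q i)⁻¹)⁻¹ k l • weightedBasisVec Q ⟨i, k⟩ := by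
  have hunit : IsUnit (CFC.sqrt (Q i)⁻¹) :=
    (CFC.isUnit_sqrt_iff _ (hQ i).inv.posSemidef.nonneg).2 (hQ i).inv.isUnit
  have hinv : CFC.sqrt (Q i)⁻¹ * (CFC.sqrt (Q i)⁻¹)⁻¹ = 1 :=
    Matrix.mul_nonsing_inv _ ((Matrix.isUnit_iff_isUnit_det _).1 hunit)
  simp only [weightedBasisVec_eq_sum, Finset.smul_sum, smul_smul]
  rw [Finset.sum_comm]
  simp only [← Finset.sum_smul, mul_comm _ (CFC.sqrt (Q i)⁻¹ _ _), ← Matrix.mul_apply, hinv,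
    Matrix.one_apply]
  simp

lemma ext_weightedBasisVec (hQ : ∀ i, (Q i).PosDef) {S T : BH n}
    (h : ∀ x, S (weightedBasisVec Q x) = T (weightedBasisVec Q x)) : S = T :=
  ext_basisVec fun x => by
    simp only [basisVec_eq_sum_weightedBasisVec hQ, map_sum, map_smul, h]

lemma invWeight_eq_sum_inner {i : I} (hQ : (Q i).PosDef) (T : BH n) :
    invWeight Q T i = ∑ l, ⟪weightedBasisVec Q ⟨i, l⟩, T (weightedBasisVec Q ⟨i, l⟩)⟫_ℂ := by
  set R := CFC.sqrt (Q i)⁻¹ with hR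
  have hRR : R * R = (Q i)⁻¹ := CFC.sqrt_mul_sqrt_self _ hQ.inv.posSemidef.nonneg
  have hRstar : R.conjTranspose = R :=
    (Matrix.nonneg_iff_posSemidef.1 (CFC.sqrt_nonneg (Q i)⁻¹)).isHermitian
  calc invWeight Q T i = (R.conjTranspose * (block T i i * R)).trace := by
        rw [invWeight, ← hRR, hRstar, Matrix.mul_assoc, Matrix.trace_mul_comm, Matrix.mul_assoc]
    _ = _ := by
      refine Finset.sum_congr rfl fun l _ => ?_
      simp only [weightedBasisVec_eq_sum, ← hR, map_sum, map_smul, sum_inner, inner_sum,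
        inner_smul_left, inner_smul_right, inner_basisVec, Matrix.diag_apply, Matrix.mul_apply,
        Matrix.conjTranspose_apply, Finset.mul_sum, block, Matrix.of_apply, RCLike.star_def]
      rw [Finset.sum_comm]
      refine Finset.sum_congr rfl fun k _ => Finset.sum_congr rfl fun k' _ => ?_
      ring

lemma modInner_eq_sum_inner {i : I} (hQ : (Q i).PosDef) (α β : BH n) :
    modInner Q α β i =
      ∑ l, ⟪α (weightedBasisVec Q ⟨i, l⟩), β (weightedBasisVec Q ⟨i, l⟩)⟫_ℂ := by
  simp [modInner, invWeight_eq_sum_inner hQ, ContinuousLinearMap.adjoint_inner_right]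

lemma norm_modInner_self {i : I} (hQ : (Q i).PosDef) (α : BH n) :
    ‖modInner Q α α i‖ = ∑ l, ‖α (weightedBasisVec Q ⟨i, l⟩)‖ ^ 2 := by
  rw [modInner_eq_sum_inner hQ, ← Complex.norm_of_nonneg (r := ∑ l, _) (by positivity)]
  simp [inner_self_eq_norm_sq_to_K]

lemma sum_norm_weightedBasisVec_sq {i : I} (hQ : (Q i).PosDef) :
    ∑ l, ‖weightedBasisVec Q ⟨i, l⟩‖ ^ 2 = ((Q i)⁻¹).trace.re := by
  have hblock : block (1 : BH n) i i = 1 := by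
    ext k l
    simp [block, basisVec_apply_same, Matrix.one_apply]
  have h := invWeight_eq_sum_inner hQ 1
  simp only [invWeight, hblock, mul_one, one_apply_eq_self, inner_self_eq_norm_sq_to_K]
    at h
  rw [h]
  norm_cast

lemma norm_invWeight_le {i : I} (hQ : (Q i).PosDef) (T : BH n) :
    ‖invWeight Q T i‖ ≤ ((Q i)⁻¹).trace.re * ‖T‖ := by
  rw [invWeight_eq_sum_inner hQ, ← sum_norm_weightedBasisVec_sq hQ, Finset.sum_mul]
  refine norm_sum_le_of_le _ fun l _ => (norm_inner_le_norm _ _).trans ?_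
  rw [sq, mul_assoc, mul_comm _ ‖T‖]
  gcongr
  exact T.le_opNorm _

lemma invWeightBounded_of_trace_inv_le (hQ : ∀ i, (Q i).PosDef) {C : ℝ}
    (hC : ∀ i, ((Q i)⁻¹).trace.re ≤ C) : InvWeightBounded Q :=
  ⟨C, fun T _ i => (norm_invWeight_le (hQ i) T).trans (by gcongr; exact hC i)⟩

end WeightedBasis

section ModuleMap

lemma orthogonalFamily_columnPart (V : Submodule ℂ (HS n)) :
    OrthogonalFamily ℂ (fun j => columnPart V j) fun j => (columnPart V j).subtypeₗᵢ := by
  intro i j hij v w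
  refine (inner_eq_sum_of_mem_columnPart v.2 _).trans (Finset.sum_eq_zero fun l _ => ?_)
  exact (congrArg _ (w.2.2 ⟨i, l⟩ hij)).trans (inner_zero_right _)

lemma hasSum_lp_apply {ι J : Type*} {E : J → Type*} [∀ j, NormedAddCommGroup (E j)] {p : ℝ≥0∞}
    [Fact (1 ≤ p)] {f : ι → lp E p} {a : lp E p} (h : HasSum f a) (x : J) :
    HasSum (fun i => f i x) (a x) :=
  h.map ((Pi.evalAddMonoidHom E x).comp (lp.coeFnAddMonoidHom E p))
    (lp.lipschitzWith_one_eval p x).continuous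

lemma exists_hasSum_smul_of_norm_le {V : Submodule ℂ (HS n)} {u : I → HS n}
    (hu : ∀ j, u j ∈ columnPart V j) {C : ℝ} (hC : ∀ j, ‖u j‖ ≤ C) :
    ∃ t : Ell2 I →L[ℂ] HS n, ∀ ξ, HasSum (fun j => ξ j • u j) (t ξ) := by
  have hF := orthogonalFamily_columnPart V
  let T (j : I) : ℂ →L[ℂ] columnPart V j := (ContinuousLinearMap.id ℂ ℂ).smulRight ⟨u j, hu j⟩
  have hT : ∀ j, ‖T j‖ ≤ |C| := fun j => by
    rw [ContinuousLinearMap.norm_smulRight_apply, ContinuousLinearMap.norm_id, one_mul]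
    exact (hC j).trans (le_abs_self C)
  exact ⟨hF.linearIsometry.toContinuousLinearMap.comp (lp.mapCLM 2 T (abs_nonneg C) hT),
    fun ξ => hF.hasSum_linearIsometry (lp.mapCLM 2 T (abs_nonneg C) hT ξ)⟩

lemma exists_isModuleMap_of_norm_le {V : Submodule ℂ (HS n)} (hV : IsClosed (V : Set (HS n)))
    {u : I → HS n} (hu : ∀ j, u j ∈ columnPart V j) {C : ℝ} (hC : ∀ j, ‖u j‖ ≤ C) :
    ∃ t : Ell2 I →L[ℂ] HS n, IsModuleMap t ∧ (∀ ξ, t ξ ∈ V) ∧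
      ∀ ξ x, t ξ x = ξ x.1 • u x.1 x := by
  classical
  obtain ⟨t, hsum⟩ := exists_hasSum_smul_of_norm_le hu hC
  have happly : ∀ ξ x, t ξ x = ξ x.1 • u x.1 x := fun ξ x => by
    refine (hasSum_lp_apply (hsum ξ) x).unique (hasSum_single x.1 fun j hj => ?_)
    rw [lp.coeFn_smul, Pi.smul_apply, (hu j).2 x hj.symm, smul_zero]
  refine ⟨t, isModuleMap_iff.2 fun ξ x => ?_, fun ξ => ?_, happly⟩
  · simp [happly]
  · exact hV.mem_of_tendsto (hsum ξ) (.of_forall fun s =>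
      V.sum_mem fun j _ => V.smul_mem _ (hu j).1)

end ModuleMap

section SelfDual

variable [DecidableEq I] {Q : ∀ i, Matrix (Fin (n i)) (Fin (n i)) ℂ} {V : Submodule ℂ (HS n)}

/-- Every bounded right `M'`-module map `ℓ²(I) → HS(H)` with values in `V` is of the form `α̂` with
`α ∈ S`. -/
def HatSurjective (Q : ∀ i, Matrix (Fin (n i)) (Fin (n i)) ℂ) (V : Submodule ℂ (HS n)) : Prop :=
  ∀ t : Ell2 I →L[ℂ] HS n, IsModuleMap t → (∀ ξ, t ξ ∈ V) →
    ∃ α ∈ modS Q V, ∀ ξ x, t ξ x = hatCol Q α ξ x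

lemma apply_weightedBasisVec_of_hatCol_eq {α : BH n} {v : HS n} {x : Idx n}
    (h : v x = hatCol Q α (lp.single 2 x.1 1) x) : α (weightedBasisVec Q x) = v x := by
  simp [h, hatCol_eq_smul]

lemma mem_modS_of_hatCol_eq (hQ : ∀ i, (Q i).PosDef) {α : BH n} {t : Ell2 I →L[ℂ] HS n}
    (htV : ∀ ξ, t ξ ∈ V) (h : ∀ ξ x, t ξ x = hatCol Q α ξ x) : α ∈ modS Q V := by
  refine ⟨⟨‖t‖ ^ 2, ?_⟩, fun ξ => ⟨t ξ, htV ξ, h ξ⟩⟩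
  rintro _ ⟨i, rfl⟩
  have hcol : ∀ l, α (weightedBasisVec Q ⟨i, l⟩) = t (lp.single 2 i 1) ⟨i, l⟩ := fun l =>
    apply_weightedBasisVec_of_hatCol_eq (h _ _)
  calc ‖modInner Q α α i‖ = ∑ l, ‖t (lp.single 2 i 1) ⟨i, l⟩‖ ^ 2 := by
        simp only [norm_modInner_self (hQ i), hcol]
    _ ≤ ‖t (lp.single 2 i 1)‖ ^ 2 := sum_norm_col_sq_le _ i
    _ ≤ ‖t‖ ^ 2 := by
        gcongr
        simpa [lp.norm_single] using t.le_opNorm (lp.single 2 i 1)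

lemma exists_mem_columnPart_of_mem_modS {α : BH n} (hα : α ∈ modS Q V) (j : I) :
    ∃ v ∈ columnPart V j, ∀ l, v ⟨j, l⟩ = α (weightedBasisVec Q ⟨j, l⟩) := by
  obtain ⟨v, hvV, hv⟩ := hα.2 (lp.single 2 j 1)
  refine ⟨v, ⟨hvV, fun x hx => ?_⟩, fun l => (apply_weightedBasisVec_of_hatCol_eq (hv _)).symm⟩
  simp [hv, hatCol_eq_smul, Pi.single_eq_of_ne hx]

lemma modNormSq_le_of_apply_weightedBasisVec (hQ : ∀ i, (Q i).PosDef) {α : BH n} {v : HS n}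
    (h : ∀ x, α (weightedBasisVec Q x) = v x) : modNormSq Q α ≤ ‖v‖ ^ 2 :=
  Real.iSup_le (fun i => by
    simpa only [norm_modInner_self (hQ i), h] using sum_norm_col_sq_le v i) (by positivity)

/-- The assumptions of `IsSelfDual`: `F` is a bounded right `M'`-module map `S → M'`, with the
square of its norm bounded by `C`. -/
structure IsModuleFunctional (Q : ∀ i, Matrix (Fin (n i)) (Fin (n i)) ℂ) (S : Set (BH n))
    (F : BH n → BH n) (C : ℝ) : Prop where
  mem_comm : ∀ α ∈ S, F α ∈ comm n
  map_add : ∀ α ∈ S, ∀ β ∈ S, F (α + β) = F α + F β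
  map_mul : ∀ α ∈ S, ∀ a ∈ comm n, F (α * a) = F α * a
  norm_sq_le : ∀ α ∈ S, ‖F α‖ ^ 2 ≤ C * modNormSq Q α

lemma HatSurjective.exists_mem_modS (h : HatSurjective Q V) (hV : IsClosed (V : Set (HS n)))
    {j : I} {v : HS n} (hv : v ∈ columnPart V j) :
    ∃ α ∈ modS Q V, ∀ x, α (weightedBasisVec Q x) = v x := by
  have hu : ∀ i, (Pi.single j v : I → HS n) i ∈ columnPart V i ∧
      ‖(Pi.single j v : I → HS n) i‖ ≤ ‖v‖ := fun i => by
    obtain rfl | hi := eq_or_ne i j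
    · simpa using hv
    · simp [Pi.single_eq_of_ne hi]
  obtain ⟨t, ht, htV, hcol⟩ :=
    exists_isModuleMap_of_norm_le hV (fun i => (hu i).1) fun i => (hu i).2
  obtain ⟨α, hα, hαt⟩ := h t ht htV
  refine ⟨α, hα, fun x => ?_⟩
  rw [apply_weightedBasisVec_of_hatCol_eq (hαt _ _), hcol]
  obtain hx | hx := eq_or_ne x.1 j
  · subst hx; simp
  · simp [Pi.single_eq_of_ne hx, hv.2 x hx]

variable [∀ i, NeZero (n i)]

namespace IsModuleFunctional

variable {F : BH n → BH n} {C : ℝ}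

lemma blockScalar_smul {S : Set (BH n)} (hF : IsModuleFunctional Q S F C) {α : BH n} (hα : α ∈ S)
    (z : ℂ) (j : I) : blockScalar (F (z • α)) j = z • blockScalar (F α) j := by
  have hz : ActsBy (z • 1 : BH n) fun _ => z := fun ξ i => rfl
  rw [← mul_one α, ← mul_smul_comm, hF.map_mul α hα _ hz.mem_comm, blockScalar_mul _ hz, mul_one,
    smul_eq_mul]

lemma exists_inner_eq_blockScalar (hF : IsModuleFunctional Q (modS Q V) F C)
    (hQ : ∀ i, (Q i).PosDef) (hV : IsClosed (V : Set (HS n))) (h : HatSurjective Q V) (j : I) :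
    ∃ u : columnPart V j, ‖u‖ ≤ √|C| ∧ ∀ (v : columnPart V j) (α : BH n),
      (∀ x, α (weightedBasisVec Q x) = (v : HS n) x) → ⟪u, v⟫_ℂ = blockScalar (F α) j := by
  have : CompleteSpace (columnPart V j) := (isClosed_columnPart hV j).completeSpace_coe
  choose A hAS hA using fun v : columnPart V j => h.exists_mem_modS hV v.2
  have hext : ∀ (v : columnPart V j) (α : BH n), (∀ x, α (weightedBasisVec Q x) = (v : HS n) x) →
      α = A v := fun v α hα => ext_weightedBasisVec hQ fun x => (hα x).trans (hA v x).symm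
  let f : columnPart V j →ₗ[ℂ] ℂ :=
    { toFun := fun v => blockScalar (F (A v)) j
      map_add' := fun v w => by
        rw [← hext (v + w) (A v + A w) (by simp [hA]), hF.map_add _ (hAS v) _ (hAS w)]
        rfl
      map_smul' := fun z v => by
        rw [← hext (z • v) (z • A v) (by simp [hA]), hF.blockScalar_smul (hAS v)]
        rfl }
  have hbound : ∀ v, ‖f v‖ ≤ √|C| * ‖v‖ := fun v => by
    refine (norm_blockScalar_le _ _).trans (le_of_sq_le_sq ?_ (by positivity))
    calc ‖F (A v)‖ ^ 2 ≤ C * modNormSq Q (A v) := hF.norm_sq_le _ (hAS v)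
      _ ≤ |C| * ‖v‖ ^ 2 := by
        gcongr
        · exact Real.iSup_nonneg fun _ => norm_nonneg _
        · exact le_abs_self C
        · exact modNormSq_le_of_apply_weightedBasisVec hQ (hA v)
      _ = (√|C| * ‖v‖) ^ 2 := by rw [mul_pow, Real.sq_sqrt (abs_nonneg C)]
  refine ⟨(InnerProductSpace.toDual ℂ _).symm (f.mkContinuous _ hbound), ?_, fun v α hα => ?_⟩
  · rw [LinearIsometryEquiv.norm_map]
    exact f.mkContinuous_norm_le (by positivity) hbound
  · rw [InnerProductSpace.toDual_symm_apply, hext v α hα]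
    rfl

lemma exists_sum_inner_eq_blockScalar (hF : IsModuleFunctional Q (modS Q V) F C)
    (hQ : ∀ i, (Q i).PosDef) (hV : IsClosed (V : Set (HS n))) (h : HatSurjective Q V) (j : I) :
    ∃ u ∈ columnPart V j, ‖u‖ ≤ √|C| ∧ ∀ α ∈ modS Q V,
      ∑ l, ⟪u ⟨j, l⟩, α (weightedBasisVec Q ⟨j, l⟩)⟫_ℂ = blockScalar (F α) j := by
  obtain ⟨u, hu, hFu⟩ := hF.exists_inner_eq_blockScalar hQ hV h j
  refine ⟨u, u.2, hu, fun α hα => ?_⟩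
  obtain ⟨v, hv, hvα⟩ := exists_mem_columnPart_of_mem_modS hα j
  obtain ⟨β, -, hβv⟩ := h.exists_mem_modS hV hv
  have hp := actsBy_blockProj (n := n) j
  have hβα : β = α * blockProj n j := ext_weightedBasisVec hQ fun x => by
    rw [hβv, mul_apply_eq_comp, hp.apply_weightedBasisVec, map_smul]
    obtain ⟨i, l⟩ := x
    obtain rfl | hi := eq_or_ne i j
    · simp [hvα]
    · simp [Pi.single_eq_of_ne hi, hv.2 ⟨i, l⟩ hi]
  calc ∑ l, ⟪(u : HS n) ⟨j, l⟩, α (weightedBasisVec Q ⟨j, l⟩)⟫_ℂ = ⟪(u : HS n), v⟫_ℂ := by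
        simp only [inner_eq_sum_of_mem_columnPart u.2, hvα]
    _ = blockScalar (F β) j := hFu ⟨v, hv⟩ β hβv
    _ = blockScalar (F α) j := by
        rw [hβα, hF.map_mul α hα _ hp.mem_comm, blockScalar_mul _ hp, Pi.single_eq_same, one_mul]

end IsModuleFunctional

theorem isSelfDual_of_hatSurjective (hQ : ∀ i, (Q i).PosDef) (hV : IsClosed (V : Set (HS n)))
    (h : HatSurjective Q V) : IsSelfDual Q (modS Q V) := by
  rintro F hcomm hadd hmul ⟨C, hC⟩
  have hF : IsModuleFunctional Q (modS Q V) F C := ⟨hcomm, hadd, hmul, hC⟩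
  choose u huV hu hFu using hF.exists_sum_inner_eq_blockScalar hQ hV h
  obtain ⟨t, ht, htV, hcol⟩ := exists_isModuleMap_of_norm_le hV huV hu
  obtain ⟨α₀, hα₀, hαt⟩ := h t ht htV
  have hα₀u : ∀ j l, α₀ (weightedBasisVec Q ⟨j, l⟩) = u j ⟨j, l⟩ := fun j l => by
    simp [apply_weightedBasisVec_of_hatCol_eq (hαt _ _), hcol]
  refine ⟨α₀, hα₀, fun α hα => ?_⟩
  have hscalar : modInner Q α₀ α = blockScalar (F α) := funext fun j => by
    simp only [modInner_eq_sum_inner (hQ j), hα₀u, hFu j α hα]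
  exact hscalar ▸ actsBy_blockScalar (hF.mem_comm α hα)

end SelfDual

section BlockDiag

variable [DecidableEq I] [∀ i, NeZero (n i)]
  {D : ∀ i, Fin (n i) → EuclideanSpace ℂ (Fin (n i)) →ₗ[ℂ] EuclideanSpace ℂ (Fin (n i))}

/-- The elements of `HS(H)` that are block diagonal and in which the `l`-th column of the
block `i` is the image under `D i l` of its `0`-th column. -/
def blockDiagSpace
    (D : ∀ i, Fin (n i) → EuclideanSpace ℂ (Fin (n i)) →ₗ[ℂ] EuclideanSpace ℂ (Fin (n i))) :
    Submodule ℂ (HS n) where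
  carrier := {v | ∀ i l, v ⟨i, l⟩ = lp.single 2 i (D i l (v ⟨i, 0⟩ i))}
  zero_mem' := by simp
  add_mem' {v w} hv hw i l := by
    rw [lp.coeFn_add, Pi.add_apply, Pi.add_apply, lp.coeFn_add, Pi.add_apply, map_add,
      lp.single_add, ← hv, ← hw]
  smul_mem' z v hv i l := by
    rw [lp.coeFn_smul, Pi.smul_apply, Pi.smul_apply, lp.coeFn_smul, Pi.smul_apply, map_smul,
      lp.single_smul, ← hv]

lemma mem_blockDiagSpace {v : HS n} :
    v ∈ blockDiagSpace D ↔ ∀ i l, v ⟨i, l⟩ = lp.single 2 i (D i l (v ⟨i, 0⟩ i)) :=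
  Iff.rfl

lemma isClosed_blockDiagSpace : IsClosed (blockDiagSpace D : Set (HS n)) := by
  have hcols : (blockDiagSpace D : Set (HS n)) =
      ⋂ (i) (l), {v : HS n | v ⟨i, l⟩ = lp.single 2 i (D i l (v ⟨i, 0⟩ i))} := by
    ext v
    simp [mem_blockDiagSpace]
  have hcol (x : Idx n) : Continuous fun v : HS n => v x :=
    (lp.lipschitzWith_one_eval 2 x).continuous
  rw [hcols]
  refine isClosed_iInter fun i => isClosed_iInter fun l => isClosed_eq (hcol _) ?_
  exact (lp.isometry_single i).continuous.comp ((D i l).continuous_of_finiteDimensional.comp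
    ((lp.lipschitzWith_one_eval 2 i).continuous.comp (hcol _)))

lemma isHSBimodule_blockDiagSpace : IsHSBimodule (blockDiagSpace D) := by
  refine ⟨isClosed_blockDiagSpace, fun v hv a ha b hb => ?_⟩
  obtain ⟨w, hw, hcol⟩ := exists_hsOp_eq_mul_mul v a hb
  refine ⟨w, fun i l => ?_, hw⟩
  have ha' := actsBy_blockScalar ha
  rw [hcol, hcol, hv i l, ha'.apply_single, lp.coeFn_smul, Pi.smul_apply, ha', map_smul, map_smul,
    lp.single_smul, lp.single_smul]

lemma mapCLM_single {E : I → Type*} [∀ i, NormedAddCommGroup (E i)] [∀ i, NormedSpace ℂ (E i)]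
    {p : ℝ≥0∞} [Fact (1 ≤ p)] (T : ∀ i, E i →L[ℂ] E i) {K : ℝ} (hK : 0 ≤ K) (hT : ∀ i, ‖T i‖ ≤ K)
    (j : I) (η : E j) : lp.mapCLM p T hK hT (lp.single p j η) = lp.single p j (T j η) := by
  ext i
  obtain rfl | hi := eq_or_ne i j
  · simp
  · simp [Pi.single_eq_of_ne hi]

theorem hatSurjective_blockDiagSpace {Q : ∀ i, Matrix (Fin (n i)) (Fin (n i)) ℂ}
    (hQ : ∀ i, (Q i).PosDef)
    (A : ∀ i, EuclideanSpace ℂ (Fin (n i)) →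
      EuclideanSpace ℂ (Fin (n i)) →L[ℂ] EuclideanSpace ℂ (Fin (n i)))
    {K : ℝ} (hK : 0 ≤ K) (hA : ∀ i c, ‖A i c‖ ≤ K * ‖c‖)
    (hAD : ∀ i l c,
      A i c (Matrix.toEuclideanLin (CFC.sqrt (Q i)⁻¹) (EuclideanSpace.single l 1)) = D i l c) :
    HatSurjective Q (blockDiagSpace D) := by
  intro t ht htV
  let c (i : I) : EuclideanSpace ℂ (Fin (n i)) := t (lp.single 2 i 1) ⟨i, 0⟩ i
  have hc : ∀ i, ‖A i (c i)‖ ≤ K * ‖t‖ := fun i => by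
    refine (hA i _).trans (mul_le_mul_of_nonneg_left ?_ hK)
    calc ‖c i‖ ≤ ‖t (lp.single 2 i 1) ⟨i, 0⟩‖ := lp.norm_apply_le_norm (by norm_num) _ _
      _ ≤ ‖t (lp.single 2 i 1)‖ := lp.norm_apply_le_norm (by norm_num) _ _
      _ ≤ ‖t‖ := by simpa [lp.norm_single] using t.le_opNorm (lp.single 2 i 1)
  let α : BH n := lp.mapCLM 2 (fun i => A i (c i)) (mul_nonneg hK (norm_nonneg t)) hc
  have hα : ∀ ξ x, t ξ x = hatCol Q α ξ x := fun ξ ⟨i, l⟩ => by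
    rw [isModuleMap_iff.1 ht ξ, htV (lp.single 2 i 1) i l, ← hAD, hatCol, mapCLM_single]
  exact ⟨α, mem_modS_of_hatCol_eq hQ htV hα, hα⟩

end BlockDiag

section DiagDensity

/-- The density matrix whose inverse is the diagonal matrix with the entries `p`. -/
def diagDensity {ι : Type*} [DecidableEq ι] (p : ι → ℝ) : Matrix ι ι ℂ :=
  Matrix.diagonal fun l => ((p l)⁻¹ : ℂ)

variable {ι : Type*} [DecidableEq ι] {p : ι → ℝ}

lemma posDef_diagDensity (hp : ∀ l, 0 < p l) : (diagDensity p).PosDef := by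
  rw [diagDensity, Matrix.posDef_diagonal_iff]
  intro l
  rw [← Complex.ofReal_inv]
  exact Complex.zero_lt_real.2 (inv_pos.2 (hp l))

variable [Fintype ι]

lemma diagDensity_inv (hp : ∀ l, 0 < p l) :
    (diagDensity p)⁻¹ = Matrix.diagonal fun l => (p l : ℂ) := by
  refine Matrix.inv_eq_right_inv ?_
  rw [diagDensity, Matrix.diagonal_mul_diagonal, ← Matrix.diagonal_one]
  congr 1
  ext l
  exact inv_mul_cancel₀ (Complex.ofReal_ne_zero.2 (hp l).ne')

lemma trace_diagDensity_inv (hp : ∀ l, 0 < p l) :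
    ((diagDensity p)⁻¹).trace = ((∑ l, p l : ℝ) : ℂ) := by
  simp [diagDensity_inv hp, Matrix.trace_diagonal]

lemma sqrt_diagDensity_inv (hp : ∀ l, 0 < p l) :
    CFC.sqrt (diagDensity p)⁻¹ = Matrix.diagonal fun l => (√(p l) : ℂ) := by
  refine CFC.sqrt_unique ?_ ?_
  · rw [diagDensity_inv hp, Matrix.diagonal_mul_diagonal]
    congr 1
    ext l
    rw [← Complex.ofReal_mul, Real.mul_self_sqrt (hp l).le]
  · rw [Matrix.nonneg_iff_posSemidef, Matrix.posSemidef_diagonal_iff]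
    exact fun l => Complex.zero_le_real.2 (Real.sqrt_nonneg _)

lemma toEuclideanLin_sqrt_diagDensity_inv_single (hp : ∀ l, 0 < p l) (l : ι) :
    Matrix.toEuclideanLin (CFC.sqrt (diagDensity p)⁻¹) (EuclideanSpace.single l 1) =
      (√(p l) : ℂ) • EuclideanSpace.single l 1 := by
  rw [sqrt_diagDensity_inv hp]
  ext k
  by_cases h : k = l
  · subst h; simp [Matrix.toLpLin_apply]
  · simp [Matrix.toLpLin_apply, h]

end DiagDensity

section Corner

lemma norm_sum_mul_le {ι : Type*} [Fintype ι] (s : Finset ι) (c η : EuclideanSpace ℂ ι) :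
    ‖∑ l ∈ s, c l * η l‖ ≤ ‖c‖ * ‖η‖ := by
  calc ‖∑ l ∈ s, c l * η l‖ ≤ ∑ l ∈ s, ‖c l‖ * ‖η l‖ :=
        norm_sum_le_of_le _ fun l _ => (norm_mul _ _).le
    _ ≤ ∑ l, ‖c l‖ * ‖η l‖ := Finset.sum_le_univ_sum_of_nonneg fun l => by positivity
    _ ≤ √(∑ l, ‖c l‖ ^ 2) * √(∑ l, ‖η l‖ ^ 2) := Real.sum_mul_le_sqrt_mul_sqrt _ _ _
    _ = ‖c‖ * ‖η‖ := by rw [← EuclideanSpace.norm_eq, ← EuclideanSpace.norm_eq]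

variable {m : ℕ} [NeZero m] {p : Fin m → ℝ}

/-- The dependence of the `l`-th column on the `0`-th column `c` for the matrices in the block of
the bimodule: for `l ≠ 0` the column is `√pₗ cₗ e₀`. -/
def cornerCol (p : Fin m → ℝ) (l : Fin m) :
    EuclideanSpace ℂ (Fin m) →ₗ[ℂ] EuclideanSpace ℂ (Fin m) :=
  if l = 0 then LinearMap.id
  else ((√(p l) : ℂ) • EuclideanSpace.projₗ l).smulRight (EuclideanSpace.single 0 1)

@[simp]
lemma cornerCol_zero (c : EuclideanSpace ℂ (Fin m)) : cornerCol p 0 c = c := by simp [cornerCol]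

lemma cornerCol_of_ne {l : Fin m} (hl : l ≠ 0) (c : EuclideanSpace ℂ (Fin m)) :
    cornerCol p l c = (√(p l) * c l : ℂ) • EuclideanSpace.single 0 1 := by
  simp [cornerCol, hl]

/-- The operator `w Q^{1/2}` for the matrix `w` with the columns `cornerCol p l c` and the density
`Q = diagDensity p`. -/
def cornerOp (p : Fin m → ℝ) (c : EuclideanSpace ℂ (Fin m)) :
    EuclideanSpace ℂ (Fin m) →L[ℂ] EuclideanSpace ℂ (Fin m) :=
  ∑ l, (((√(p l))⁻¹ : ℂ) • (EuclideanSpace.proj l : EuclideanSpace ℂ (Fin m) →L[ℂ] ℂ)).smulRight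
    (cornerCol p l c)

lemma cornerOp_apply (c η : EuclideanSpace ℂ (Fin m)) :
    cornerOp p c η = ∑ l, ((√(p l))⁻¹ * η l : ℂ) • cornerCol p l c := by
  simp [cornerOp]

lemma cornerOp_apply_sqrt_smul_single (hp : ∀ l, 0 < p l) (c : EuclideanSpace ℂ (Fin m))
    (l : Fin m) : cornerOp p c ((√(p l) : ℂ) • EuclideanSpace.single l 1) = cornerCol p l c := by
  have hne : (√(p l) : ℂ) ≠ 0 := Complex.ofReal_ne_zero.2 (Real.sqrt_pos.2 (hp l)).ne'
  rw [cornerOp_apply, Finset.sum_eq_single l (fun k _ hk => by simp [hk]) (by simp)]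
  simp [hne]

lemma cornerOp_apply_eq_add (hp : ∀ l, 0 < p l) (c η : EuclideanSpace ℂ (Fin m)) :
    cornerOp p c η = ((√(p 0))⁻¹ * η 0 : ℂ) • c +
      (∑ l ∈ Finset.univ.erase 0, c l * η l) • EuclideanSpace.single 0 1 := by
  rw [cornerOp_apply, ← Finset.add_sum_erase _ _ (Finset.mem_univ 0), cornerCol_zero,
    Finset.sum_smul]
  congr 1
  refine Finset.sum_congr rfl fun l hl => ?_
  have hne : (√(p l) : ℂ) ≠ 0 := Complex.ofReal_ne_zero.2 (Real.sqrt_pos.2 (hp l)).ne'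
  rw [cornerCol_of_ne (Finset.ne_of_mem_erase hl), smul_smul]
  congr 1
  push_cast
  field_simp

lemma norm_cornerOp_le (hp : ∀ l, 0 < p l) (c : EuclideanSpace ℂ (Fin m)) :
    ‖cornerOp p c‖ ≤ ((√(p 0))⁻¹ + 1) * ‖c‖ := by
  refine ContinuousLinearMap.opNorm_le_bound _ (by positivity) fun η => ?_
  rw [cornerOp_apply_eq_add hp]
  calc _ ≤ (√(p 0))⁻¹ * ‖η 0‖ * ‖c‖ + ‖∑ l ∈ Finset.univ.erase 0, c l * η l‖ := by
        refine (norm_add_le _ _).trans_eq ?_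
        simp [norm_smul, abs_of_nonneg]
    _ ≤ (√(p 0))⁻¹ * ‖η‖ * ‖c‖ + ‖c‖ * ‖η‖ := by
        gcongr
        exacts [PiLp.norm_apply_le η 0, norm_sum_mul_le _ c η]
    _ = ((√(p 0))⁻¹ + 1) * ‖c‖ * ‖η‖ := by ring

end Corner

section CornerSpace

variable [DecidableEq I] [∀ i, NeZero (n i)] {p : ∀ i, Fin (n i) → ℝ}

theorem hatSurjective_corner (hp : ∀ i l, 0 < p i l) {δ : ℝ} (hδ : 0 < δ) (hpδ : ∀ i, δ ≤ p i 0) :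
    HatSurjective (fun i => diagDensity (p i)) (blockDiagSpace fun i => cornerCol (p i)) := by
  refine hatSurjective_blockDiagSpace (fun i => posDef_diagDensity (hp i))
    (fun i => cornerOp (p i)) (K := (√δ)⁻¹ + 1) (by positivity) (fun i c => ?_) fun i l c => ?_
  · refine (norm_cornerOp_le (hp i) c).trans ?_
    gcongr
    exact hpδ i
  · rw [toEuclideanLin_sqrt_diagDensity_inv_single (hp i), cornerOp_apply_sqrt_smul_single (hp i)]

end CornerSpace

section NotIntegrable

lemma norm_inner_le_mul_norm_starProjection {E : Type*} [NormedAddCommGroup E]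
    [InnerProductSpace ℂ E] {V : Submodule ℂ E} [V.HasOrthogonalProjection] {v : E} (hv : v ∈ V)
    (w : E) : ‖⟪v, w⟫_ℂ‖ ≤ ‖v‖ * ‖V.starProjection w‖ := by
  rw [← Submodule.starProjection_eq_self_iff.2 hv, Submodule.inner_starProjection_left_eq_right,
    Submodule.starProjection_eq_self_iff.2 hv]
  exact norm_inner_le_norm _ _

variable [DecidableEq I] {V : Submodule ℂ (HS n)} [V.HasOrthogonalProjection]
  {p : ∀ i, Fin (n i) → ℝ}

lemma re_slice_starProjection_self (ξ : Hil n) (i : I) (k : Fin (n i)) :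
    (slice V.starProjection ξ i k k).re =
      ‖V.starProjection (lp.single 2 (⟨i, k⟩ : Idx n) ξ)‖ ^ 2 := by
  let v : HS n := lp.single 2 (⟨i, k⟩ : Idx n) ξ
  calc (slice V.starProjection ξ i k k).re = RCLike.re ⟪V.starProjection v, v⟫_ℂ :=
        congrArg Complex.re (V.inner_starProjection_left_eq_right v v).symm
    _ = ‖V.starProjection v‖ ^ 2 := V.re_inner_starProjection_eq_normSq v

lemma re_trace_diagDensity_mul {ι : Type*} [Fintype ι] [DecidableEq ι] (p : ι → ℝ)
    (A : Matrix ι ι ℂ) : (diagDensity p * A).trace.re = ∑ k, (p k)⁻¹ * (A k k).re := by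
  simp [Matrix.trace, diagDensity, Matrix.diagonal_mul, ← Complex.ofReal_inv]

lemma IsIntegrable.exists_sum_le
    (h : IsIntegrable (fun i => diagDensity (p i)) V.starProjection) :
    ∃ C : ℝ, ∀ (j : I) (ξ : Hil n),
      ∑ k, (p j k)⁻¹ * ‖V.starProjection (lp.single 2 (⟨j, k⟩ : Idx n) ξ)‖ ^ 2 ≤ C * ‖ξ‖ ^ 2 := by
  obtain ⟨C, hC⟩ := h
  refine ⟨|C|, fun j ξ => ?_⟩
  have hj := (ENNReal.le_tsum j).trans (hC ξ)
  simp only [re_trace_diagDensity_mul, re_slice_starProjection_self] at hj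
  have habs : C * ‖ξ‖ ^ 2 ≤ |C| * ‖ξ‖ ^ 2 := by gcongr; exact le_abs_self C
  exact (ENNReal.ofReal_le_ofReal_iff (by positivity)).1
    (hj.trans (ENNReal.ofReal_le_ofReal habs))

variable [∀ i, NeZero (n i)]

/-- The element of the corner bimodule whose block `j` has the `k`-th unit vector as its `0`-th
column (for `k ≠ 0`).  It is used to bound from below the component in the bimodule of the operator
whose only non-zero column, the `k`-th one of the block `j`, is the `0`-th unit vector. -/
def colUnit (p : ∀ i, Fin (n i) → ℝ) (j : I) (k : Fin (n j)) : HS n :=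
  lp.single 2 ⟨j, k⟩ ((√(p j k) : ℂ) • basisVec n ⟨j, 0⟩) + lp.single 2 ⟨j, 0⟩ (basisVec n ⟨j, k⟩)

lemma colUnit_apply_zero {j : I} {k : Fin (n j)} (hk : k ≠ 0) :
    colUnit p j k ⟨j, 0⟩ = basisVec n ⟨j, k⟩ := by
  simp [colUnit, hk.symm]

lemma colUnit_apply_self {j : I} {k : Fin (n j)} (hk : k ≠ 0) :
    colUnit p j k ⟨j, k⟩ = (√(p j k) : ℂ) • basisVec n ⟨j, 0⟩ := by
  simp [colUnit, hk]

lemma colUnit_mem_blockDiagSpace {j : I} {k : Fin (n j)} (hk : k ≠ 0) :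
    colUnit p j k ∈ blockDiagSpace fun i => cornerCol (p i) := by
  refine mem_blockDiagSpace.2 fun i l => ?_
  obtain rfl | hi := eq_or_ne i j
  · obtain rfl | hl := eq_or_ne l 0
    · rw [cornerCol_zero, colUnit_apply_zero hk]
      simp [basisVec]
    rw [cornerCol_of_ne hl, colUnit_apply_zero hk, basisVec_apply_same]
    obtain rfl | hlk := eq_or_ne l k
    · rw [colUnit_apply_self hk, if_pos rfl, mul_one, lp.single_smul, basisVec]
    · simp [colUnit, hl, hlk]
  · simp [colUnit, hi]

lemma norm_colUnit_le {j : I} {k : Fin (n j)} (hp : p j k ≤ 1) : ‖colUnit p j k‖ ≤ 2 := by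
  calc ‖colUnit p j k‖ ≤ √(p j k) + 1 := by
        refine (norm_add_le _ _).trans_eq ?_
        rw [lp.norm_single (by norm_num), lp.norm_single (by norm_num), norm_smul, norm_basisVec,
          norm_basisVec, mul_one, Complex.norm_of_nonneg (Real.sqrt_nonneg _)]
    _ ≤ 2 := by linarith [Real.sqrt_le_one.2 hp]

lemma quarter_le_inv_mul_norm_starProjection_sq
    [(blockDiagSpace fun i => cornerCol (p i)).HasOrthogonalProjection] {j : I} {k : Fin (n j)}
    (hk : k ≠ 0) (hp : 0 < p j k) (hp1 : p j k ≤ 1) :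
    1 / 4 ≤ (p j k)⁻¹ * ‖(blockDiagSpace fun i => cornerCol (p i)).starProjection
      (lp.single 2 (⟨j, k⟩ : Idx n) (basisVec n ⟨j, 0⟩))‖ ^ 2 := by
  set v : HS n := lp.single 2 (⟨j, k⟩ : Idx n) (basisVec n ⟨j, 0⟩)
  set r := ‖(blockDiagSpace fun i => cornerCol (p i)).starProjection v‖
  have hinner : ⟪colUnit p j k, v⟫_ℂ = √(p j k) := by
    rw [lp.inner_single_right, colUnit_apply_self hk, inner_smul_left, inner_basisVec,
      basisVec_apply_same]
    simp
  have hle : √(p j k) ≤ 2 * r := by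
    calc √(p j k) = ‖⟪colUnit p j k, v⟫_ℂ‖ := by
          rw [hinner, Complex.norm_of_nonneg (Real.sqrt_nonneg _)]
      _ ≤ ‖colUnit p j k‖ * r :=
          norm_inner_le_mul_norm_starProjection (colUnit_mem_blockDiagSpace hk) v
      _ ≤ 2 * r := by gcongr; exact norm_colUnit_le hp1
  have hsq : p j k ≤ (2 * r) ^ 2 := (Real.sqrt_le_left (by positivity)).1 hle
  rw [inv_mul_eq_div, le_div_iff₀ hp]
  linarith

lemma sub_one_mul_le_sum {m : ℕ} [NeZero m] {f : Fin m → ℝ} {b : ℝ} (h0 : 0 ≤ f 0)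
    (hb : ∀ k ≠ 0, b ≤ f k) : ((m : ℝ) - 1) * b ≤ ∑ k, f k := by
  have hcard : ((Finset.univ.erase (0 : Fin m)).card : ℝ) = m - 1 := by
    simp [Nat.cast_sub (NeZero.one_le : 1 ≤ m)]
  have hsum := Finset.card_nsmul_le_sum (Finset.univ.erase (0 : Fin m)) f b
    fun k hk => hb k (Finset.ne_of_mem_erase hk)
  rw [nsmul_eq_mul, hcard] at hsum
  rw [← Finset.add_sum_erase _ _ (Finset.mem_univ 0)]
  linarith

theorem not_isIntegrable_corner
    [(blockDiagSpace fun i => cornerCol (p i)).HasOrthogonalProjection]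
    (hp : ∀ i l, 0 < p i l) (hp1 : ∀ i l, p i l ≤ 1) (hn : ¬ BddAbove (Set.range n)) :
    ¬ IsIntegrable (fun i => diagDensity (p i))
      (blockDiagSpace fun i => cornerCol (p i)).starProjection := by
  intro h
  obtain ⟨C, hC⟩ := h.exists_sum_le
  refine hn ⟨⌈4 * C + 1⌉₊, ?_⟩
  rintro _ ⟨j, rfl⟩
  have hsum : ((n j : ℝ) - 1) * (1 / 4) ≤ C := by
    refine le_trans (sub_one_mul_le_sum ?_ fun k hk =>
      quarter_le_inv_mul_norm_starProjection_sq hk (hp j k) (hp1 j k))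
      ((hC j (basisVec n ⟨j, 0⟩)).trans_eq (by simp))
    have := hp j 0
    positivity
  have hceil : (n j : ℝ) ≤ ⌈4 * C + 1⌉₊ := le_trans (by linarith) (Nat.le_ceil _)
  exact_mod_cast hceil

end NotIntegrable

section ProbVec

variable {m : ℕ} [NeZero m]

/-- The mean of the uniform probability vector and the point mass at `0`: a probability vector with
positive entries whose `0`-th entry is bounded below independently of `m`. -/
def probVec (l : Fin m) : ℝ := ((m : ℝ)⁻¹ + if l = 0 then 1 else 0) / 2

lemma probVec_pos (l : Fin m) : 0 < probVec l := by
  have hm : (0 : ℝ) < m := Nat.cast_pos.2 (NeZero.pos m)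
  unfold probVec
  split_ifs <;> positivity

lemma half_le_probVec_zero : 1 / 2 ≤ probVec (0 : Fin m) := by
  have hm : (0 : ℝ) ≤ (m : ℝ)⁻¹ := by positivity
  simp only [probVec, if_true]
  linarith

lemma sum_probVec : ∑ l : Fin m, probVec l = 1 := by
  have hm : (m : ℝ) ≠ 0 := Nat.cast_ne_zero.2 (NeZero.ne m)
  simp only [probVec, ← Finset.sum_div, Finset.sum_add_distrib]
  simp [hm]

lemma probVec_le_one (l : Fin m) : probVec l ≤ 1 :=
  sum_probVec (m := m) ▸
    Finset.single_le_sum (fun k _ => (probVec_pos k).le) (Finset.mem_univ l)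

end ProbVec

end MatrixQG

end

theorem mainTheorem11 {I : Type*} [DecidableEq I] (n : I → ℕ) (hpos : ∀ i, 0 < n i)
    (hn : ¬ BddAbove (Set.range n)) :
    ∃ Q : ∀ i, Matrix (Fin (n i)) (Fin (n i)) ℂ,
      (∀ i, (Q i).PosDef) ∧ (∀ i, ((Q i)⁻¹).trace = 1) ∧ MatrixQG.InvWeightBounded Q ∧
      ∃ V : Submodule ℂ (MatrixQG.HS n), MatrixQG.IsHSBimodule V ∧
        MatrixQG.IsSelfDual Q (MatrixQG.modS Q V) ∧
        (∀ t : MatrixQG.Ell2 I →L[ℂ] MatrixQG.HS n, MatrixQG.IsModuleMap t → (∀ ξ, t ξ ∈ V) →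
          ∃ α ∈ MatrixQG.modS Q V, ∀ ξ x, t ξ x = MatrixQG.hatCol Q α ξ x) ∧
        ∃ e : MatrixQG.HS n →L[ℂ] MatrixQG.HS n, IsStarProjection e ∧
          LinearMap.range e.toLinearMap = V ∧ ¬ MatrixQG.IsIntegrable Q e := by
  have (i : I) : NeZero (n i) := ⟨(hpos i).ne'⟩
  let p (i : I) : Fin (n i) → ℝ := MatrixQG.probVec
  let V := MatrixQG.blockDiagSpace fun i => MatrixQG.cornerCol (p i)
  have hp (i : I) (l : Fin (n i)) : 0 < p i l := MatrixQG.probVec_pos l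
  have hQ (i : I) : (MatrixQG.diagDensity (p i)).PosDef := MatrixQG.posDef_diagDensity (hp i)
  have htr (i : I) : (MatrixQG.diagDensity (p i))⁻¹.trace = 1 := by
    rw [MatrixQG.trace_diagDensity_inv (hp i), MatrixQG.sum_probVec, Complex.ofReal_one]
  have hV : MatrixQG.IsHSBimodule V := MatrixQG.isHSBimodule_blockDiagSpace
  have hhat : MatrixQG.HatSurjective (fun i => MatrixQG.diagDensity (p i)) V :=
    MatrixQG.hatSurjective_corner hp one_half_pos fun i => MatrixQG.half_le_probVec_zero
  have : CompleteSpace V := hV.1.completeSpace_coe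
  exact ⟨fun i => MatrixQG.diagDensity (p i), hQ, htr,
    MatrixQG.invWeightBounded_of_trace_inv_le hQ (C := 1) fun i => by simp [htr],
    V, hV, MatrixQG.isSelfDual_of_hatSurjective hQ hV.1 hhat, hhat,
    V.starProjection, isStarProjection_starProjection, Submodule.range_starProjection V,
    MatrixQG.not_isIntegrable_corner hp (fun i => MatrixQG.probVec_le_one) hn⟩
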